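/- Let $M$ (for instance the local algebra $\mathcal{A}(\mathcal{O})$ of a quantum field theory) be a von Neumann algebra on a complex Hilbert space $\mathcal{H}$, and let $\Omega\in\mathcal{H}$ be a unit vector that is cyclic ($M\Omega$ is dense in $\mathcal{H}$) and separating ($A\in M$, $A\Omega=0$ imply $A=0$) for $M$. Let $\overline{S}$ be the closure of the antilinear operator $A\Omega\mapsto A^*\Omega$, $A\in M$, let $\overline{S}=J\Delta^{1/2}$ be its polar decomposition, with $J$ antiunitary and $\Delta^{1/2}$ positive and self-adjoint, and let $\Delta=(\Delta^{1/2})^2$ be the modular operator and $K=-\log\Delta$ the modular Hamiltonian. For a vector $\xi$ let $\mu_{\xi}$ be the spectral measure of $K$ at $\xi$; the expectation $\langle K\rangle_{\xi}=\int x\,d\mu_{\xi}(x)$ is called finite if $x$ is $\mu_{\xi}$-integrable. Let $B\in M$ satisfy $\|B\|\le 1$ and $B\Omega\neq 0$, put $\hat\xi=B\Omega/\|B\Omega\|$, and let $p_{\mathrm{succ}}(B)=\|B\Omega\|^2$ be the probability, in the state $\Omega$, of the outcome with Kraus operator $B$. Then $\hat\xi$ lies in the domain of $\Delta^{1/2}$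 and $$p_{\mathrm{succ}}(B)\le\|\Delta^{1/2}\hat\xi\|^{-2}.$$ If $\langle K\rangle_{\hat\xi}$ is finite, then moreover $$p_{\mathrm{succ}}(B)^{-1}\ge\exp\bigl[-\langle K\rangle_{\hat\xi}\bigr].$$ -/

import Mathlib

open MeasureTheory
open scoped InnerProductSpace

namespace TomitaTakesaki

noncomputable section

variable {H : Type*} [NormedAddCommGroup H] [InnerProductSpace ℂ H] [CompleteSpace H]

/-- `Ω` is cyclic for `M`: the subspace `M Ω` is dense. -/
def IsCyclicVector (M : VonNeumannAlgebra H) (Ω : H) : Prop :=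
  Dense {x : H | ∃ A ∈ M, A Ω = x}

/-- `Ω` is separating for `M`: an element of `M` that kills `Ω` is zero
(equivalently, `A ↦ A Ω` is injective on `M`). -/
def IsSeparatingVector (M : VonNeumannAlgebra H) (Ω : H) : Prop :=
  ∀ A ∈ M, A Ω = 0 → A = 0

/-- The graph of the Tomita operator `S : A Ω ↦ A* Ω`, `A ∈ M`. It is the graph of an antilinear map
when `Ω` is separating. -/
def tomitaGraph (M : VonNeumannAlgebra H) (Ω : H) : Set (H × H) :=
  {p | ∃ A ∈ M, p = (A Ω, (star A) Ω)}

/-- The graph of the closure of the Tomita operator. -/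
def tomitaClosureGraph (M : VonNeumannAlgebra H) (Ω : H) : Set (H × H) :=
  closure (tomitaGraph M Ω)

/-- A positive self-adjoint, in general unbounded, operator. -/
structure IsPositiveSelfAdjoint (D : H →ₗ.[ℂ] H) : Prop where
  selfAdjoint : IsSelfAdjoint D
  nonneg : ∀ x : D.domain, 0 ≤ (⟪(x : H), D x⟫_ℂ).re

/-- The operator with graph `G` has the polar decomposition `J D`, with `J` antiunitary and `D`
positive and self-adjoint. The operator `D` is determined by `G`. -/
structure IsPolarDecomposition (G : Set (H × H)) (J : H ≃ₗᵢ⋆[ℂ] H) (D : H →ₗ.[ℂ] H) : Prop where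
  positive : IsPositiveSelfAdjoint D
  graph_eq : G = {p | ∃ x : D.domain, p = ((x : H), J (D x))}

open Classical in
/-- The operator `Δ^{1/2}`: the positive self-adjoint factor in the polar decomposition
`J Δ^{1/2}` of the closure of the Tomita operator of `(M, Ω)`. -/
def modularSqrt (M : VonNeumannAlgebra H) (Ω : H) : H →ₗ.[ℂ] H :=
  if h : ∃ D : H →ₗ.[ℂ] H, ∃ J : H ≃ₗᵢ⋆[ℂ] H, IsPolarDecomposition (tomitaClosureGraph M Ω) J D
  then h.choose else 0

/-- The square `D ∘ D` of an unbounded operator, on its natural domain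
`{x ∈ dom D | D x ∈ dom D}`. -/
def square (D : H →ₗ.[ℂ] H) : H →ₗ.[ℂ] H where
  domain :=
    { carrier := {x | ∃ h : x ∈ D.domain, D ⟨x, h⟩ ∈ D.domain}
      zero_mem' := ⟨D.domain.zero_mem, by
        have h0 : D ⟨0, D.domain.zero_mem⟩ = 0 := D.map_zero
        rw [h0]
        exact D.domain.zero_mem⟩
      add_mem' := by
        rintro x y ⟨hx, hx'⟩ ⟨hy, hy'⟩
        refine ⟨D.domain.add_mem hx hy, ?_⟩
        have h0 : D ⟨x + y, D.domain.add_mem hx hy⟩ = D ⟨x, hx⟩ + D ⟨y, hy⟩ :=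
          D.map_add ⟨x, hx⟩ ⟨y, hy⟩
        rw [h0]
        exact D.domain.add_mem hx' hy'
      smul_mem' := by
        rintro c x ⟨hx, hx'⟩
        refine ⟨D.domain.smul_mem c hx, ?_⟩
        have h0 : D ⟨c • x, D.domain.smul_mem c hx⟩ = c • D ⟨x, hx⟩ :=
          D.map_smul c ⟨x, hx⟩
        rw [h0]
        exact D.domain.smul_mem c hx' }
  toFun :=
    { toFun := fun x => D ⟨D ⟨(x : H), x.2.1⟩, x.2.2⟩
      map_add' := by
        rintro ⟨x, hx, hx'⟩ ⟨y, hy, hy'⟩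
        have h0 : D ⟨x + y, D.domain.add_mem hx hy⟩ = D ⟨x, hx⟩ + D ⟨y, hy⟩ :=
          D.map_add ⟨x, hx⟩ ⟨y, hy⟩
        exact (congrArg D (Subtype.ext h0)).trans (D.map_add ⟨_, hx'⟩ ⟨_, hy'⟩)
      map_smul' := by
        rintro c ⟨x, hx, hx'⟩
        have h0 : D ⟨c • x, D.domain.smul_mem c hx⟩ = c • D ⟨x, hx⟩ :=
          D.map_smul c ⟨x, hx⟩
        exact (congrArg D (Subtype.ext h0)).trans (D.map_smul c ⟨_, hx'⟩) }

/-- The modular operator `Δ` of `(M, Ω)`. -/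
def modularOperator (M : VonNeumannAlgebra H) (Ω : H) : H →ₗ.[ℂ] H :=
  square (modularSqrt M Ω)

/-- The bounded operator `R` is `(1 + A)⁻¹`. -/
structure IsOneAddInverse (A : H →ₗ.[ℂ] H) (R : H →L[ℂ] H) : Prop where
  right_inv : ∀ x : H, ∃ h : R x ∈ A.domain, R x + A ⟨R x, h⟩ = x
  left_inv : ∀ x : A.domain, R ((x : H) + A x) = x

/-- `μ` is the spectral measure at the vector `ξ` of the positive self-adjoint operator `A`: the
finite measure on `[0, ∞)` with `∫ g dμ = ⟪ξ, g(A) ξ⟫` for the functions `g(t) = f((1 + t)⁻¹)`,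
`f` continuous, where `g(A) = f((1 + A)⁻¹)` is given by the continuous functional calculus of the
bounded self-adjoint operator `(1 + A)⁻¹`. These `g` include all continuous functions on `[0, ∞)`
with a limit at infinity, so `μ` is determined by `A` and `ξ`. -/
structure IsSpectralMeasureAt (A : H →ₗ.[ℂ] H) (ξ : H) (μ : Measure ℝ) : Prop where
  finite : IsFiniteMeasure μ
  supported : μ (Set.Iio 0) = 0
  integral_eq : ∃ R : H →L[ℂ] H, IsOneAddInverse A R ∧ ∀ f : ℝ → ℝ, Continuous f →
    ((∫ t, f ((1 + t)⁻¹) ∂μ : ℝ) : ℂ) = ⟪ξ, cfc f R ξ⟫_ℂ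

open Classical in
/-- The spectral measure at `ξ` of a positive self-adjoint operator `A`. -/
def spectralMeasureAt (A : H →ₗ.[ℂ] H) (ξ : H) : Measure ℝ :=
  if h : ∃ μ : Measure ℝ, IsSpectralMeasureAt A ξ μ then h.choose else 0

/-- The spectral measure at `ξ` of the modular Hamiltonian `K = -log Δ`: the image of the spectral
measure of `Δ` at `ξ` under `t ↦ -log t`. (The point `0` is not charged, as `Δ` is injective.) -/
def modularEnergyMeasure (M : VonNeumannAlgebra H) (Ω ξ : H) : Measure ℝ :=
  (spectralMeasureAt (modularOperator M Ω) ξ).map fun t => -Real.log t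

/-- The expectation `⟨K⟩_ξ` of the modular Hamiltonian is finite. -/
def HasFiniteModularEnergy (M : VonNeumannAlgebra H) (Ω ξ : H) : Prop :=
  Integrable (fun x : ℝ => x) (modularEnergyMeasure M Ω ξ)

/-- The expectation `⟨K⟩_ξ` of the modular Hamiltonian in the vector `ξ`. -/
def modularEnergy (M : VonNeumannAlgebra H) (Ω ξ : H) : ℝ :=
  ∫ x, x ∂(modularEnergyMeasure M Ω ξ)

/-- The probability, in the state `Ω`, of the outcome with Kraus operator `B`. -/
def successProbability (Ω : H) (B : H →L[ℂ] H) : ℝ := ‖B Ω‖ ^ 2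

/-- The normalized vector `x / ‖x‖`. -/
def normalized (x : H) : H := ((‖x‖ : ℂ)⁻¹) • x

end

end TomitaTakesaki

/-! The closure of the Tomita operator sends `B Ω` to `star B Ω` and `J` preserves norms, so
`‖Δ^{1/2} B Ω‖ = ‖star B Ω‖ ≤ 1`. Dividing by `‖B Ω‖` bounds `‖Δ^{1/2} ξ̂‖²` by the inverse success
probability. For the spectral measure `μ` of `Δ` at `ξ̂`, Jensen's inequality then gives `exp (-⟨K⟩)
= exp (∫ log t ∂μ) ≤ ∫ t ∂μ ≤ ‖Δ^{1/2} ξ̂‖²`.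

Most of the work shows that the objects defined by choice exist: the polar decomposition
(`exists_isPolarDecomposition`) and the spectral measure (`exists_isSpectralMeasureAt_square`). Both
reduce to bounded operators, since the graph of a closed operator is a Hilbert space with bounded
coordinate projections. The moment bound `∫ t ∂μ ≤ ‖D ξ‖²` is `integrable_and_integral_le`. -/

namespace TomitaTakesaki

/-! ### Polar decomposition of bounded operators -/

section BoundedOperators

open scoped InnerProduct

variable {E F : Type*} [NormedAddCommGroup E] [InnerProductSpace ℂ E] [CompleteSpace E]
  [NormedAddCommGroup F] [InnerProductSpace ℂ F] [CompleteSpace F]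

theorem injective_adjoint_of_denseRange {T : E →L[ℂ] F} (hT : DenseRange T) :
    Function.Injective (T†) := by
  rw [injective_iff_map_eq_zero]
  intro y hy
  refine hT.eq_zero_of_inner_right ℂ (x := y) fun x => ?_
  rw [← ContinuousLinearMap.adjoint_inner_right, hy, inner_zero_right]

theorem denseRange_of_injective_adjoint {T : E →L[ℂ] F} (hT : Function.Injective (T†)) :
    DenseRange T := by
  have h : (T : E →ₗ[ℂ] F).range.topologicalClosure = ⊤ := by
    rw [Submodule.topologicalClosure_eq_top_iff, ContinuousLinearMap.orthogonal_range]
    exact LinearMap.ker_eq_bot.2 hT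
  rw [← Submodule.dense_iff_topologicalClosure_eq_top] at h
  exact h

theorem denseRange_of_isSelfAdjoint {T : E →L[ℂ] E} (hT : IsSelfAdjoint T)
    (hinj : Function.Injective T) : DenseRange T :=
  denseRange_of_injective_adjoint (by rwa [← ContinuousLinearMap.star_eq_adjoint, hT.star_eq])

/-- Polar decomposition of an injective bounded operator with dense range. -/
theorem exists_linearIsometryEquiv_sqrt {T : E →L[ℂ] F} (hinj : Function.Injective T)
    (hdense : DenseRange T) :
    ∃ U : E ≃ₗᵢ[ℂ] F, ∀ x, U (CFC.sqrt (T† ∘L T) x) = T x := by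
  have hpos : 0 ≤ T† ∘L T :=
    (ContinuousLinearMap.nonneg_iff_isPositive _).2 (ContinuousLinearMap.isPositive_adjoint_comp_self T)
  set A : E →L[ℂ] E := CFC.sqrt (T† ∘L T)
  have hAsa : IsSelfAdjoint A := (CFC.sqrt_nonneg _).isSelfAdjoint
  have hsq : A * A = T† ∘L T := CFC.sqrt_mul_sqrt_self _ hpos
  have hnorm : ∀ x, ‖T x‖ = ‖A x‖ := by
    intro x
    have h1 : ⟪A x, A x⟫_ℂ = ⟪T x, T x⟫_ℂ := by
      rw [← ContinuousLinearMap.adjoint_inner_left, ← ContinuousLinearMap.star_eq_adjoint,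
        hAsa.star_eq, ← ContinuousLinearMap.adjoint_inner_left T]
      exact congrArg (fun B : E →L[ℂ] E => ⟪B x, x⟫_ℂ) hsq
    rw [inner_self_eq_norm_sq_to_K, inner_self_eq_norm_sq_to_K] at h1
    have h2 : ‖A x‖ ^ 2 = ‖T x‖ ^ 2 := by exact_mod_cast h1
    exact ((sq_eq_sq₀ (norm_nonneg _) (norm_nonneg _)).1 h2).symm
  have hAinj : Function.Injective A := by
    rw [injective_iff_map_eq_zero]
    intro x hx
    refine (injective_iff_map_eq_zero T).1 hinj x ?_
    rw [← norm_eq_zero, hnorm, hx, norm_zero]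
  -- The map `A x ↦ T x` is isometric between dense ranges, so it extends to a unitary.
  exact ⟨(LinearEquiv.refl ℂ E).extendOfIsometry (A : E →ₗ[ℂ] E) (T : E →ₗ[ℂ] F)
    (denseRange_of_isSelfAdjoint hAsa hAinj) hdense hnorm,
    fun x => LinearEquiv.extendOfIsometry_eq _ _ _ _ _ _ x⟩

/-- Complex conjugation of the coordinates in a Hilbert basis. It serves to turn the antilinear
Tomita operator into a linear one. -/
theorem exists_antiunitary : Nonempty (E ≃ₗᵢ⋆[ℂ] E) := by
  obtain ⟨w, b, -⟩ := exists_hilbertBasis ℂ E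
  exact ⟨(b.repr.trans (starₗᵢ ℂ)).trans b.repr.symm⟩

end BoundedOperators

/-! ### Polar decomposition of closed operators through their graphs -/

section ClosedOperators

open scoped InnerProduct

variable {H : Type*} [NormedAddCommGroup H] [InnerProductSpace ℂ H] [CompleteSpace H]

/-- Data describing a positive self-adjoint operator `C A⁻¹` through its bounded parts. -/
structure IsCosSinPair (A C : H →L[ℂ] H) : Prop where
  nonneg_left : 0 ≤ A
  nonneg_right : 0 ≤ C
  commute : Commute A C
  sq_add_sq : A * A + C * C = 1
  injective : Function.Injective A

namespace IsCosSinPair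

variable {A C : H →L[ℂ] H} (h : IsCosSinPair A C)
include h

theorem inner_left (x y : H) : ⟪A x, y⟫_ℂ = ⟪x, A y⟫_ℂ := by
  conv_lhs => rw [← h.nonneg_left.isSelfAdjoint.star_eq]
  rw [ContinuousLinearMap.star_eq_adjoint, ContinuousLinearMap.adjoint_inner_left]

theorem inner_right (x y : H) : ⟪C x, y⟫_ℂ = ⟪x, C y⟫_ℂ := by
  conv_lhs => rw [← h.nonneg_right.isSelfAdjoint.star_eq]
  rw [ContinuousLinearMap.star_eq_adjoint, ContinuousLinearMap.adjoint_inner_left]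

omit [CompleteSpace H] in
theorem apply_comm (x : H) : A (C x) = C (A x) :=
  congrArg (fun B : H →L[ℂ] H => B x) h.commute

omit [CompleteSpace H] in
theorem apply_sq_add_sq (x : H) : A (A x) + C (C x) = x :=
  congrArg (fun B : H →L[ℂ] H => B x) h.sq_add_sq

/-- The operator is `D = C A⁻¹` on the range of `A`. It is symmetric because `A` and `C` commute,
and positive because `A C ≥ 0`. -/
theorem exists_isPositiveSelfAdjoint :
    ∃ D : H →ₗ.[ℂ] H, IsPositiveSelfAdjoint D ∧
      ∀ p : H × H, (∃ x : D.domain, p = ((x : H), D x)) ↔ ∃ y, p = (A y, C y) := by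
  let e : H ≃ₗ[ℂ] (A : H →ₗ[ℂ] H).range := LinearEquiv.ofInjective (A : H →ₗ[ℂ] H) h.injective
  let D : H →ₗ.[ℂ] H :=
    { domain := (A : H →ₗ[ℂ] H).range
      toFun := (C : H →ₗ[ℂ] H) ∘ₗ (e.symm : (A : H →ₗ[ℂ] H).range →ₗ[ℂ] H) }
  have hmem : ∀ y, A y ∈ D.domain := fun y => ⟨y, rfl⟩
  have happ : ∀ y, D ⟨A y, hmem y⟩ = C y := by
    intro y
    change C (e.symm ⟨A y, hmem y⟩) = C y
    congr 1
    exact e.symm_apply_apply y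
  have hex : ∀ x : D.domain, ∃ y, x = ⟨A y, hmem y⟩ := by
    rintro ⟨_, y, rfl⟩
    exact ⟨y, rfl⟩
  have hdense : Dense (D.domain : Set H) :=
    denseRange_of_isSelfAdjoint h.nonneg_left.isSelfAdjoint h.injective
  have hsymm : D.IsFormalAdjoint D := by
    intro x y
    obtain ⟨x, rfl⟩ := hex x
    obtain ⟨y, rfl⟩ := hex y
    rw [happ, happ]
    change ⟪C x, A y⟫_ℂ = ⟪A x, C y⟫_ℂ
    rw [h.inner_right, h.inner_left, h.apply_comm]
  refine ⟨D, ⟨?_, ?_⟩, ?_⟩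
  · rw [LinearPMap.isSelfAdjoint_def]
    refine le_antisymm ?_ (LinearPMap.IsFormalAdjoint.le_adjoint hdense hsymm)
    have hadj := LinearPMap.adjoint_isFormalAdjoint hdense
    have hkey : ∀ w : D.adjoint.domain, ∃ y, (w : H) = A y ∧ D.adjoint w = C y := by
      intro w
      have h1 : C (w : H) = A (D.adjoint w) := by
        refine ext_inner_right ℂ fun y => ?_
        rw [h.inner_right, h.inner_left]
        have := hadj w ⟨A y, hmem y⟩
        rw [happ] at this
        exact this.symm
      -- The witness inverts `y ↦ (A y, C y)`: with `C w = A (D* w)` and `A² + C² = 1`, applying `A`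
      -- and `C` returns `w` and `D* w`.
      refine ⟨A w + C (D.adjoint w), ?_, ?_⟩
      · rw [map_add, h.apply_comm, ← h1, h.apply_sq_add_sq]
      · rw [map_add, ← h.apply_comm, h1, h.apply_sq_add_sq]
    refine ⟨fun w hw => ?_, fun w x hwx => ?_⟩
    · obtain ⟨y, hy, -⟩ := hkey ⟨w, hw⟩
      change w = A y at hy
      rw [hy]
      exact hmem y
    · obtain ⟨y, hy, hy'⟩ := hkey w
      have : x = ⟨A y, hmem y⟩ := Subtype.ext (by rw [← hwx, hy])
      rw [hy', this, happ]
  · intro x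
    obtain ⟨y, rfl⟩ := hex x
    rw [happ]
    change 0 ≤ (⟪A y, C y⟫_ℂ).re
    rw [h.inner_left]
    exact ((ContinuousLinearMap.nonneg_iff_isPositive _).1
      (h.commute.mul_nonneg h.nonneg_left h.nonneg_right)).re_inner_nonneg_right y
  · intro p
    constructor
    · rintro ⟨x, rfl⟩
      obtain ⟨y, rfl⟩ := hex x
      exact ⟨y, by rw [happ]⟩
    · rintro ⟨y, rfl⟩
      exact ⟨⟨A y, hmem y⟩, by rw [happ]⟩

end IsCosSinPair

/-- The graph of a closed, densely defined, injective operator with dense range is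
`{(A y, V C y)}` with `V` unitary and `A`, `C` positive, commuting, `A² + C² = 1`. -/
theorem exists_isCosSinPair_of_isClosed (Γ : Submodule ℂ (WithLp 2 (H × H)))
    (hΓ : IsClosed (Γ : Set (WithLp 2 (H × H))))
    (hfst : ∀ z ∈ Γ, z.fst = 0 → z = 0) (hsnd : ∀ z ∈ Γ, z.snd = 0 → z = 0)
    (hfst' : Dense {x | ∃ z ∈ Γ, z.fst = x}) (hsnd' : Dense {x | ∃ z ∈ Γ, z.snd = x}) :
    ∃ A C : H →L[ℂ] H, IsCosSinPair A C ∧ ∃ V : H ≃ₗᵢ[ℂ] H,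
      ∀ x y : H, WithLp.toLp 2 (x, y) ∈ Γ ↔ ∃ u, x = A u ∧ y = V (C u) := by
  have : CompleteSpace Γ := hΓ.completeSpace_coe
  let p : Γ →L[ℂ] H := WithLp.fstL 2 ℂ H H ∘L Γ.subtypeL
  let q : Γ →L[ℂ] H := WithLp.sndL 2 ℂ H H ∘L Γ.subtypeL
  have hp : ∀ z : Γ, p z = (z : WithLp 2 (H × H)).fst := fun _ => rfl
  have hq : ∀ z : Γ, q z = (z : WithLp 2 (H × H)).snd := fun _ => rfl
  have hpinj : Function.Injective p :=
    (injective_iff_map_eq_zero p).2 fun z hz => Subtype.ext (hfst z z.2 hz)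
  have hqinj : Function.Injective q :=
    (injective_iff_map_eq_zero q).2 fun z hz => Subtype.ext (hsnd z z.2 hz)
  have hpd : DenseRange p := by
    refine hfst'.mono ?_
    rintro x ⟨z, hz, rfl⟩
    exact ⟨⟨z, hz⟩, rfl⟩
  have hqd : DenseRange q := by
    refine hsnd'.mono ?_
    rintro x ⟨z, hz, rfl⟩
    exact ⟨⟨z, hz⟩, rfl⟩
  have hpa : Function.Injective (p†) := injective_adjoint_of_denseRange hpd
  have hpad : DenseRange (p†) :=
    denseRange_of_injective_adjoint (by rwa [ContinuousLinearMap.adjoint_adjoint])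
  -- The polar part `W` of `p†` parametrizes the graph by `H` so that the first coordinate becomes
  -- the positive operator `A = p W`. The second coordinate `T = q W` is then itself polar
  -- decomposed as `V C`.
  obtain ⟨W, hW⟩ := exists_linearIsometryEquiv_sqrt hpa hpad
  set A : H →L[ℂ] H := CFC.sqrt (p†† ∘L p†)
  have hA0 : 0 ≤ A := CFC.sqrt_nonneg _
  have hAs : ∀ x y, ⟪A x, y⟫_ℂ = ⟪x, A y⟫_ℂ := fun x y => by
    conv_lhs => rw [← hA0.isSelfAdjoint.star_eq]
    rw [ContinuousLinearMap.star_eq_adjoint, ContinuousLinearMap.adjoint_inner_left]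
  have hpW : ∀ x, p (W x) = A x := by
    intro x
    refine ext_inner_right ℂ fun y => ?_
    rw [← ContinuousLinearMap.adjoint_inner_right, ← hW, LinearIsometryEquiv.inner_map_map, hAs]
  let T : H →L[ℂ] H := q ∘L (W.toContinuousLinearEquiv : H →L[ℂ] Γ)
  have hT : ∀ x, T x = q (W x) := fun _ => rfl
  obtain ⟨V, hV⟩ := exists_linearIsometryEquiv_sqrt (T := T) (hqinj.comp W.injective)
    (hqd.comp W.surjective.denseRange q.continuous)
  have hQpos : 0 ≤ T† ∘L T := (ContinuousLinearMap.nonneg_iff_isPositive _).2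
    (ContinuousLinearMap.isPositive_adjoint_comp_self _)
  have hcc : CFC.sqrt (T† ∘L T) * CFC.sqrt (T† ∘L T) = T† ∘L T := CFC.sqrt_mul_sqrt_self _ hQpos
  -- `W` is isometric, and the inner product of the graph is the sum over both coordinates.
  have hsum : A * A + T† ∘L T = 1 := by
    ext x
    refine ext_inner_right ℂ fun y => ?_
    change ⟪A (A x) + (T†) (T x), y⟫_ℂ = ⟪x, y⟫_ℂ
    rw [inner_add_left, ContinuousLinearMap.adjoint_inner_left, hAs, hT, hT, ← hpW, ← hpW, hp, hp, hq, hq, ← W.inner_map_map x y, Submodule.coe_inner,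
      WithLp.prod_inner_apply]
    rfl
  have hcomm : Commute A (CFC.sqrt (T† ∘L T)) := by
    have h1 : Commute (T† ∘L T) A := by
      rw [← eq_sub_iff_add_eq'] at hsum
      rw [hsum]
      exact (Commute.one_left A).sub_left ((Commute.refl A).mul_left (Commute.refl A))
    exact (h1.cfcₙ_nnreal NNReal.sqrt).symm
  refine ⟨A, CFC.sqrt (T† ∘L T), ⟨hA0, CFC.sqrt_nonneg _, hcomm, by rw [hcc, hsum], ?_⟩, V, ?_⟩
  · intro x y hxy
    rw [← hpW, ← hpW] at hxy
    exact W.injective (hpinj hxy)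
  · intro x y
    constructor
    · intro hxy
      obtain ⟨u, hu⟩ := W.surjective ⟨_, hxy⟩
      exact ⟨u, by rw [← hpW, hu]; rfl, by rw [hV, hT, hu]; rfl⟩
    · rintro ⟨u, rfl, rfl⟩
      have : WithLp.toLp 2 (A u, V (CFC.sqrt (T† ∘L T) u)) = (W u : WithLp 2 (H × H)) := by
        rw [hV, ← hpW, hT, hp, hq]
        rfl
      rw [this]
      exact (W u).2

end ClosedOperators

/-! ### The resolvent of the square of a self-adjoint operator -/

section Resolvent

open scoped InnerProduct

variable {H : Type*} [NormedAddCommGroup H] [InnerProductSpace ℂ H] [CompleteSpace H]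

theorem inner_apply_left {D : H →ₗ.[ℂ] H} (hD : IsSelfAdjoint D) (x y : D.domain) :
    ⟪D x, (y : H)⟫_ℂ = ⟪(x : H), D y⟫_ℂ := by
  have h := LinearPMap.adjoint_isFormalAdjoint hD.dense_domain
  rw [LinearPMap.isSelfAdjoint_def.1 hD] at h
  exact h x y

theorem exists_apply_eq_of_inner {D : H →ₗ.[ℂ] H} (hD : IsSelfAdjoint D) {w v : H}
    (h : ∀ x : D.domain, ⟪v, (x : H)⟫_ℂ = ⟪w, D x⟫_ℂ) : ∃ hw : w ∈ D.domain, D ⟨w, hw⟩ = v := by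
  have h1 : ∃ hw : w ∈ D.adjoint.domain, D.adjoint ⟨w, hw⟩ = v :=
    ⟨LinearPMap.mem_adjoint_domain_of_exists w ⟨v, h⟩,
      LinearPMap.adjoint_apply_eq hD.dense_domain _ h⟩
  rwa [LinearPMap.isSelfAdjoint_def.1 hD] at h1

/-- The bounded inverse of `1 + D²` for a self-adjoint `D`. -/
theorem exists_isOneAddInverse_square {D : H →ₗ.[ℂ] H} (hD : IsSelfAdjoint D) :
    ∃ R : H →L[ℂ] H, IsOneAddInverse (square D) R := by
  let Γ : Submodule ℂ (WithLp 2 (H × H)) :=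
    D.graph.comap (WithLp.linearEquiv 2 ℂ (H × H) : WithLp 2 (H × H) →ₗ[ℂ] H × H)
  have hΓ : IsClosed (Γ : Set (WithLp 2 (H × H))) :=
    hD.isClosed.preimage (WithLp.prod_continuous_ofLp 2 H H)
  have : CompleteSpace Γ := hΓ.completeSpace_coe
  have hmem : ∀ x : D.domain, WithLp.toLp 2 ((x : H), D x) ∈ Γ := fun x =>
    (LinearPMap.mem_graph_iff D).2 ⟨x, rfl, rfl⟩
  have hex : ∀ z : Γ, ∃ x : D.domain, z = ⟨_, hmem x⟩ := by
    rintro ⟨z, hz⟩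
    obtain ⟨x, hx, hx'⟩ := (LinearPMap.mem_graph_iff D).1 hz
    refine ⟨x, Subtype.ext ((WithLp.ofLp_injective 2) (Prod.ext hx.symm hx'.symm))⟩
  let p : Γ →L[ℂ] H := WithLp.fstL 2 ℂ H H ∘L Γ.subtypeL
  have hp : ∀ x : D.domain, p ⟨_, hmem x⟩ = x := fun _ => rfl
  have hinner : ∀ x y : D.domain, ⟪(⟨_, hmem x⟩ : Γ), (⟨_, hmem y⟩ : Γ)⟫_ℂ =
      ⟪(x : H), (y : H)⟫_ℂ + ⟪D x, D y⟫_ℂ := fun x y => by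
    rw [Submodule.coe_inner, WithLp.prod_inner_apply]
  -- The vector `p† y = (x, D x)` is characterized by `⟪y, z⟫ = ⟪x, z⟫ + ⟪D x, D z⟫` for all `z` in
  -- the domain, that is, by `y = x + D² x`.
  refine ⟨p ∘L p†, ⟨fun y => ?_, fun x => ?_⟩⟩
  · obtain ⟨x, hx⟩ := hex ((p†) y)
    have hRy : (p ∘L p†) y = x := by rw [ContinuousLinearMap.comp_apply, hx, hp]
    have h1 : ∀ z : D.domain, ⟪y - x, (z : H)⟫_ℂ = ⟪D x, D z⟫_ℂ := by
      intro z
      have h2 := ContinuousLinearMap.adjoint_inner_left p ⟨_, hmem z⟩ y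
      rw [hx, hinner, hp] at h2
      rw [inner_sub_left, ← h2, add_sub_cancel_left]
    obtain ⟨h3, h4⟩ := exists_apply_eq_of_inner hD h1
    rw [hRy]
    refine ⟨⟨x.2, h3⟩, ?_⟩
    change (x : H) + D ⟨D x, h3⟩ = y
    rw [h4, add_sub_cancel]
  · obtain ⟨x, hx, hx'⟩ := x
    change (p ∘L p†) (x + D ⟨D ⟨x, hx⟩, hx'⟩) = x
    have h1 : (p†) (x + D ⟨D ⟨x, hx⟩, hx'⟩) = ⟨_, hmem ⟨x, hx⟩⟩ := by
      refine ext_inner_right ℂ fun z => ?_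
      obtain ⟨z, rfl⟩ := hex z
      rw [ContinuousLinearMap.adjoint_inner_left, hp, hinner, inner_add_left,
        inner_apply_left hD]
    rw [ContinuousLinearMap.comp_apply, h1, hp]

section

variable {D : H →ₗ.[ℂ] H} {R : H →L[ℂ] H}

omit [CompleteSpace H] in
theorem IsOneAddInverse.exists_square (hR : IsOneAddInverse (square D) R) (y : H) :
    ∃ a b : D.domain, (a : H) = R y ∧ (b : H) = D a ∧ D b = y - R y := by
  obtain ⟨⟨h1, h2⟩, h3⟩ := hR.right_inv y
  exact ⟨⟨R y, h1⟩, ⟨_, h2⟩, rfl, rfl, eq_sub_of_add_eq' h3⟩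

omit [CompleteSpace H] in
theorem IsOneAddInverse.injective (hR : IsOneAddInverse (square D) R) : Function.Injective R := by
  rw [injective_iff_map_eq_zero]
  intro y hy
  obtain ⟨a, b, ha, hb, hab⟩ := hR.exists_square y
  have ha0 : a = 0 := Subtype.ext (by rw [ha, hy]; rfl)
  have hb0 : b = 0 := Subtype.ext (by rw [hb, ha0, LinearPMap.map_zero]; rfl)
  rw [hb0, LinearPMap.map_zero, hy, sub_zero] at hab
  exact hab.symm

omit [CompleteSpace H] in
theorem IsOneAddInverse.one_sub_injective (hR : IsOneAddInverse (square D) R)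
    (hinj : ∀ x : D.domain, D x = 0 → x = 0) :
    Function.Injective (R - 1 : H →L[ℂ] H) := by
  rw [injective_iff_map_eq_zero]
  intro y hy
  have hy' : y - R y = 0 := by
    change R y - y = 0 at hy
    rw [← neg_sub, hy, neg_zero]
  obtain ⟨a, b, ha, hb, hab⟩ := hR.exists_square y
  have hb0 := hinj b (hab.trans hy')
  have ha0 := hinj a (by rw [← hb, hb0]; rfl)
  rw [sub_eq_zero.1 hy', ← ha, ha0]
  rfl

variable (hD : IsSelfAdjoint D) (hR : IsOneAddInverse (square D) R)
include hD hR

/-- Writing `y = a + D² a` with `a = R y` gives `⟪R y, y⟫ = ‖a‖² + ‖D a‖²`. The analogous formula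
for `1 - R` confines the spectrum to `[0, 1]`. -/
theorem IsOneAddInverse.isPositive : R.IsPositive := by
  rw [ContinuousLinearMap.isPositive_iff_complex]
  intro y
  obtain ⟨a, b, ha, hb, hab⟩ := hR.exists_square y
  have h1 : ⟪R y, y⟫_ℂ = ((‖(a : H)‖ ^ 2 + ‖D a‖ ^ 2 : ℝ) : ℂ) := by
    have h2 : ⟪R y, y⟫_ℂ = ⟪(a : H), (a : H) + D b⟫_ℂ := by rw [hab, ha, add_sub_cancel]
    rw [h2, inner_add_right, ← inner_apply_left hD, hb, inner_self_eq_norm_sq_to_K,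
      inner_self_eq_norm_sq_to_K]
    push_cast
    rfl
  have h0 : 0 ≤ ‖(a : H)‖ ^ 2 + ‖D a‖ ^ 2 := by positivity
  rw [h1]
  exact ⟨congrArg Complex.ofReal (Complex.ofReal_re _), h0⟩

theorem IsOneAddInverse.one_sub_isPositive : (1 - R).IsPositive := by
  rw [ContinuousLinearMap.isPositive_iff_complex]
  intro y
  obtain ⟨a, b, ha, hb, hab⟩ := hR.exists_square y
  have h1 : ⟪(1 - R) y, y⟫_ℂ = ((‖D a‖ ^ 2 + ‖D b‖ ^ 2 : ℝ) : ℂ) := by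
    have h2 : ⟪(1 - R) y, y⟫_ℂ = ⟪D b, (a : H) + D b⟫_ℂ := by
      rw [hab, ha, add_sub_cancel]
      rfl
    rw [h2, inner_add_right, inner_apply_left hD, hb, inner_self_eq_norm_sq_to_K,
      inner_self_eq_norm_sq_to_K]
    push_cast
    rfl
  have h0 : 0 ≤ ‖D a‖ ^ 2 + ‖D b‖ ^ 2 := by positivity
  rw [h1]
  exact ⟨congrArg Complex.ofReal (Complex.ofReal_re _), h0⟩

theorem IsOneAddInverse.spectrum_subset : spectrum ℝ R ⊆ Set.Icc 0 1 := by
  have hpos := (ContinuousLinearMap.nonneg_iff_isPositive R).2 (hR.isPositive hD)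
  have hle : R ≤ 1 := (ContinuousLinearMap.le_def _ _).2 (hR.one_sub_isPositive hD)
  exact fun s hs => ⟨spectrum_nonneg_of_nonneg hpos hs,
    (CFC.le_one_iff (R := ℝ) R hpos.isSelfAdjoint).1 hle s hs⟩

end

end Resolvent

/-! ### Spectral measures -/

section SpectralMeasure

variable {H : Type*} [NormedAddCommGroup H] [InnerProductSpace ℂ H] [CompleteSpace H]

/-- The spectral measure of a bounded self-adjoint operator. -/
theorem exists_measure_integral_eq_inner_cfc {T : H →L[ℂ] H} (hT : IsSelfAdjoint T) (ξ : H) :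
    ∃ ν : Measure ℝ, IsFiniteMeasure ν ∧ ν (spectrum ℝ T)ᶜ = 0 ∧
      ∀ f : ℝ → ℝ, Continuous f → ((∫ s, f s ∂ν : ℝ) : ℂ) = ⟪ξ, cfc f T ξ⟫_ℂ := by
  -- Riesz–Markov applies to the positive functional `g ↦ re ⟪ξ, g(T) ξ⟫` on the compact spectrum.
  let Λ : CompactlySupportedContinuousMap (spectrum ℝ T) ℝ →ₚ[ℝ] ℝ :=
    { toFun g := (⟪ξ, cfcHom hT g.toContinuousMap ξ⟫_ℂ).re
      map_add' g g' := by
        have : (g + g').toContinuousMap = g.toContinuousMap + g'.toContinuousMap := rfl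
        rw [this, map_add, add_apply, inner_add_right, Complex.add_re]
      map_smul' c g := by
        have : (c • g).toContinuousMap = c • g.toContinuousMap := rfl
        rw [this, map_smul, smul_apply, inner_smul_right_eq_smul]
        simp
      monotone' g g' hgg' := by
        have h1 : cfcHom hT g.toContinuousMap ≤ cfcHom hT g'.toContinuousMap :=
          cfcHom_mono hT hgg'
        have h2 := ((ContinuousLinearMap.le_def _ _).1 h1).re_inner_nonneg_right ξ
        rw [sub_apply, inner_sub_right] at h2
        simpa using h2 }
  let ν₀ := RealRMK.rieszMeasure Λ
  have hν₀ : IsFiniteMeasure ν₀ := inferInstance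
  refine ⟨ν₀.map Subtype.val, inferInstance, ?_, fun f hf => ?_⟩
  · rw [Measure.map_apply measurable_subtype_coe (spectrum.isCompact T).measurableSet.compl]
    simp
  · rw [integral_map measurable_subtype_coe.aemeasurable hf.aestronglyMeasurable]
    let g : CompactlySupportedContinuousMap (spectrum ℝ T) ℝ :=
      { toFun := fun s => f s
        continuous_toFun := hf.comp continuous_subtype_val
        hasCompactSupport' := HasCompactSupport.of_compactSpace _ }
    have h1 : ∫ s, f s ∂ν₀ = (⟪ξ, cfc f T ξ⟫_ℂ).re := by
      rw [cfc_apply f T hT hf.continuousOn]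
      exact RealRMK.integral_rieszMeasure Λ g
    rw [h1]
    have h2 : IsSelfAdjoint (cfc f T) := cfc_predicate f T
    have h3 := h2.isSymmetric.coe_re_inner_self_apply ξ
    exact h3

/-- The spectral measure of `T` has no atom at a point which is not an eigenvalue. -/
theorem measure_singleton_eq_zero_of_injective {T : H →L[ℂ] H} (hT : IsSelfAdjoint T) {ξ : H}
    {ν : Measure ℝ} [IsFiniteMeasure ν]
    (hν : ∀ f : ℝ → ℝ, Continuous f → ((∫ s, f s ∂ν : ℝ) : ℂ) = ⟪ξ, cfc f T ξ⟫_ℂ)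
    {c : ℝ} (hc : Function.Injective (T - algebraMap ℝ (H →L[ℂ] H) c)) : ν {c} = 0 := by
  have hTc : T - algebraMap ℝ (H →L[ℂ] H) c = cfc (fun s => s - c) T := by
    rw [cfc_sub (fun s => s) (fun _ => c) T, cfc_id' ℝ T, cfc_const c T]
  have hdense := denseRange_of_isSelfAdjoint (T := T - algebraMap ℝ (H →L[ℂ] H) c)
    (by rw [hTc]; exact cfc_predicate _ T) hc
  -- The range of `T - c` is dense, so `ξ` is `δ`-close to some `(T - c) η`. A peak function `f` at
  -- `c` has `‖f(T)‖ ≤ 1` and `‖f(T) (T - c)‖ ≤ 1/n`, and `n > ‖η‖/δ` makes both contributions to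
  -- `f(T) ξ` at most `δ`.
  have hbound : ∀ δ : ℝ, 0 < δ → ν.real {c} ≤ ‖ξ‖ * (δ + δ) := by
    intro δ hδ
    obtain ⟨η, hη⟩ := Metric.denseRange_iff.1 hdense ξ δ hδ
    obtain ⟨n, hn⟩ := exists_nat_gt (‖η‖ / δ)
    have hn0 : (0 : ℝ) < n := lt_of_le_of_lt (by positivity) hn
    let f : ℝ → ℝ := fun s => (1 + n * |s - c|)⁻¹
    have hpos : ∀ s, 0 < 1 + n * |s - c| := fun s => by positivity
    have hf : Continuous f := Continuous.inv₀ (by fun_prop) fun s => (hpos s).ne'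
    have hf0 : ∀ s, 0 ≤ f s := fun s => (inv_pos.2 (hpos s)).le
    have hf1 : ∀ s, f s ≤ 1 := fun s => inv_le_one_of_one_le₀ (by
      have : 0 ≤ n * |s - c| := by positivity
      linarith)
    have hint : Integrable f ν := Integrable.of_bound hf.aestronglyMeasurable 1
      (Filter.Eventually.of_forall fun s => by rw [Real.norm_of_nonneg (hf0 s)]; exact hf1 s)
    have h1 : ν.real {c} ≤ ∫ s, f s ∂ν := by
      have h2 : ∫ s, Set.indicator {c} (fun _ => (1 : ℝ)) s ∂ν = ν.real {c} := by
        rw [integral_indicator (measurableSet_singleton c)]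
        simp [Measure.real]
      rw [← h2]
      refine integral_mono ((integrable_const _).indicator (measurableSet_singleton c)) hint ?_
      intro s
      by_cases hs : s = c
      · subst hs
        simp [f]
      · simpa [Set.indicator, hs] using hf0 s
    have hcf : ‖cfc f T‖ ≤ 1 := norm_cfc_le zero_le_one fun s _ => by
      rw [Real.norm_of_nonneg (hf0 s)]; exact hf1 s
    have hcg : ‖cfc f T * (T - algebraMap ℝ (H →L[ℂ] H) c)‖ ≤ (n : ℝ)⁻¹ := by
      rw [hTc, ← cfc_mul f _ T hf.continuousOn]
      refine norm_cfc_le (by positivity) fun s _ => ?_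
      rw [Real.norm_eq_abs, abs_mul, abs_of_nonneg (hf0 s), inv_mul_eq_div, div_le_iff₀ (hpos s),
        inv_mul_eq_div, le_div_iff₀ hn0]
      linarith
    have hsplit : cfc f T ξ = cfc f T (ξ - (T - algebraMap ℝ (H →L[ℂ] H) c) η) +
        (cfc f T * (T - algebraMap ℝ (H →L[ℂ] H) c)) η := by
      rw [map_sub]
      exact (sub_add_cancel _ _).symm
    have hnorm : ‖cfc f T ξ‖ ≤ δ + δ := by
      rw [hsplit]
      refine (norm_add_le _ _).trans (add_le_add ?_ ?_)
      · refine ((cfc f T).le_of_opNorm_le hcf _).trans ?_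
        rw [one_mul, ← dist_eq_norm]
        exact hη.le
      · refine (ContinuousLinearMap.le_of_opNorm_le _ hcg _).trans ?_
        rw [inv_mul_eq_div, div_le_iff₀ hn0]
        rw [div_lt_iff₀ hδ] at hn
        linarith
    calc ν.real {c} ≤ ∫ s, f s ∂ν := h1
      _ ≤ ‖((∫ s, f s ∂ν : ℝ) : ℂ)‖ := by
        rw [Complex.norm_real]
        exact le_abs_self _
      _ = ‖⟪ξ, cfc f T ξ⟫_ℂ‖ := by rw [hν f hf]
      _ ≤ ‖ξ‖ * ‖cfc f T ξ‖ := norm_inner_le_norm _ _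
      _ ≤ ‖ξ‖ * (δ + δ) := by gcongr
  have h0 : ν.real {c} ≤ 0 := by
    refine le_of_forall_pos_le_add fun ε hε => ?_
    have h1 := hbound (ε / (2 * (‖ξ‖ + 1))) (by positivity)
    refine h1.trans ?_
    rw [zero_add, ← two_mul, mul_div_assoc']
    rw [mul_div_assoc', div_le_iff₀ (by positivity)]
    nlinarith [norm_nonneg ξ]
  exact (measureReal_eq_zero_iff).1 (le_antisymm h0 measureReal_nonneg)

/-- The spectral measure of `R = (1 + D²)⁻¹` is transported by `s ↦ s⁻¹ - 1`, the inverse of `t ↦ (1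
+ t)⁻¹`. -/
theorem exists_isSpectralMeasureAt_square {D : H →ₗ.[ℂ] H} (hD : IsSelfAdjoint D) (ξ : H) :
    ∃ μ : Measure ℝ, IsSpectralMeasureAt (square D) ξ μ := by
  obtain ⟨R, hR⟩ := exists_isOneAddInverse_square hD
  have hRsa : IsSelfAdjoint R := (hR.isPositive hD).isSelfAdjoint
  obtain ⟨ν, hfin, hsupp, hν⟩ := exists_measure_integral_eq_inner_cfc hRsa ξ
  have h0 : ν {0} = 0 := measure_singleton_eq_zero_of_injective hRsa hν
    (by rw [map_zero, sub_zero]; exact hR.injective)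
  have hmeas : Measurable fun s : ℝ => s⁻¹ - 1 := by fun_prop
  refine ⟨ν.map fun s => s⁻¹ - 1, inferInstance, ?_, R, hR, fun f hf => ?_⟩
  · rw [Measure.map_apply hmeas measurableSet_Iio]
    -- Since `0⁻¹ = 0`, an atom at `s = 0` would land at `-1`; injectivity of `R` excludes it.
    refine measure_mono_null (t := {0} ∪ (spectrum ℝ R)ᶜ) (fun s hs => ?_)
      (measure_union_null h0 hsupp)
    by_contra hcon
    simp only [Set.mem_union, Set.mem_singleton_iff, Set.mem_compl_iff, not_or, not_not] at hcon
    obtain ⟨hs0, hs1⟩ := hR.spectrum_subset hD hcon.2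
    have h1 : 1 ≤ s⁻¹ := (one_le_inv₀ (lt_of_le_of_ne hs0 (Ne.symm hcon.1))).2 hs1
    have h2 : s⁻¹ - 1 < 0 := hs
    linarith
  · have hfm : Measurable fun t : ℝ => f (1 + t)⁻¹ := hf.measurable.comp (by fun_prop)
    rw [integral_map hmeas.aemeasurable hfm.aestronglyMeasurable]
    simp only [add_sub_cancel, inv_inv]
    exact hν f hf

end SpectralMeasure

/-! ### Moments of the spectral measure and Jensen's inequality -/

section Moments

variable {H : Type*} [NormedAddCommGroup H] [InnerProductSpace ℂ H] [CompleteSpace H]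

section

variable {A : H →ₗ.[ℂ] H} {ξ : H} {μ : Measure ℝ}

theorem ae_nonneg_of_measure_Iio {μ : Measure ℝ} (h : μ (Set.Iio 0) = 0) : ∀ᵐ t ∂μ, 0 ≤ t := by
  rw [ae_iff]
  simpa [Set.Iio] using h

theorem IsSpectralMeasureAt.integrable_comp (hμ : IsSpectralMeasureAt A ξ μ) {f : ℝ → ℝ}
    (hf : Continuous f) : Integrable (fun t => f (1 + t)⁻¹) μ := by
  have := hμ.finite
  obtain ⟨C, hC⟩ := (isCompact_Icc (a := (0 : ℝ)) (b := 1)).exists_bound_of_continuousOn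
    hf.continuousOn
  have hfm : Measurable fun t : ℝ => f (1 + t)⁻¹ := hf.measurable.comp (by fun_prop)
  refine Integrable.of_bound hfm.aestronglyMeasurable C ?_
  filter_upwards [ae_nonneg_of_measure_Iio hμ.supported] with t ht
  exact hC _ ⟨by positivity, inv_le_one_of_one_le₀ (by linarith)⟩

end

variable {D : H →ₗ.[ℂ] H} {ξ : H} {μ : Measure ℝ}

theorem IsSpectralMeasureAt.measureReal_univ (hμ : IsSpectralMeasureAt (square D) ξ μ)
    (hD : IsSelfAdjoint D) : μ.real Set.univ = ‖ξ‖ ^ 2 := by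
  obtain ⟨R, hR, h⟩ := hμ.integral_eq
  have hsa : IsSelfAdjoint R := (hR.isPositive hD).isSelfAdjoint
  have h1 := h (fun _ => 1) continuous_const
  rw [cfc_const_one ℝ R, one_apply_eq_self, inner_self_eq_norm_sq_to_K] at h1
  simp only [integral_const, smul_eq_mul, mul_one] at h1
  exact Complex.ofReal_injective (h1.trans (by push_cast; rfl))

/-- The point `t = 0` corresponds to `s = 1`, and `1` is not an eigenvalue of `R` when `D` is
injective. -/
theorem IsSpectralMeasureAt.measure_zero (hμ : IsSpectralMeasureAt (square D) ξ μ)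
    (hD : IsSelfAdjoint D) (hinj : ∀ x : D.domain, D x = 0 → x = 0) : μ {0} = 0 := by
  have := hμ.finite
  obtain ⟨R, hR, h⟩ := hμ.integral_eq
  have hmeas : Measurable fun t : ℝ => (1 + t)⁻¹ := by fun_prop
  have h1 : (μ.map fun t => (1 + t)⁻¹) {1} = 0 := by
    refine measure_singleton_eq_zero_of_injective (hR.isPositive hD).isSelfAdjoint (ξ := ξ)
      (fun f hf => ?_) (by rw [map_one]; exact hR.one_sub_injective hinj)
    rw [integral_map hmeas.aemeasurable hf.aestronglyMeasurable]
    exact h f hf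
  rw [Measure.map_apply hmeas (measurableSet_singleton 1)] at h1
  exact measure_mono_null (by simp) h1

/-- The regularized second moment of `D` is bounded by `‖D ξ‖²`. -/
theorem IsSpectralMeasureAt.integral_regularized_le {ξ : D.domain}
    (hμ : IsSpectralMeasureAt (square D) ξ μ) (hD : IsSelfAdjoint D) {ε : ℝ} (hε : 0 < ε) :
    ∫ t, (1 - (1 + t)⁻¹) * (|(1 + t)⁻¹| + ε)⁻¹ ∂μ ≤ ‖D ξ‖ ^ 2 := by
  obtain ⟨R, hR, h⟩ := hμ.integral_eq
  have hsa : IsSelfAdjoint R := (hR.isPositive hD).isSelfAdjoint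
  -- In the variable `s = (1 + t)⁻¹` the first moment is that of `(1 - s)/s`, singular at `s = 0`;
  -- `k` is a continuous substitute for `1/s`. With `η = k(R) ξ` and `b = D R η`, one has `∫ g = ⟪D
  -- ξ, b⟫` and `∫ m = ‖b‖²`, while `s k(s) ≤ 1` gives `m ≤ g`.
  let k : ℝ → ℝ := fun s => (|s| + ε)⁻¹
  have hkc : Continuous k := Continuous.inv₀ (by fun_prop) fun s => by positivity
  let g : ℝ → ℝ := fun s => (1 - s) * k s
  let m : ℝ → ℝ := fun s => k s * (s * ((1 - s) * k s))
  have hgc : Continuous g := by fun_prop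
  have hmc : Continuous m := by fun_prop
  have hone : cfc (fun s : ℝ => 1 - s) R = 1 - R := by
    rw [cfc_sub (fun _ => 1) (fun s => s) R, cfc_id' ℝ R, cfc_const_one ℝ R]
  have hg : cfc g R = (1 - R) * cfc k R := by
    rw [← hone, ← cfc_mul _ k R (by fun_prop) hkc.continuousOn]
  have hm : cfc m R = cfc k R * (R * ((1 - R) * cfc k R)) := by
    rw [← hg, cfc_mul k (fun s => s * g s) R hkc.continuousOn (by fun_prop),
      cfc_mul (fun s => s) g R (by fun_prop) hgc.continuousOn, cfc_id' ℝ R]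
  have hsymm : ∀ {T : H →L[ℂ] H}, IsSelfAdjoint T → ∀ x y, ⟪T x, y⟫_ℂ = ⟪x, T y⟫_ℂ :=
    fun hT x y => hT.isSymmetric x y
  set η : H := cfc k R ξ with hη
  obtain ⟨a, b, ha, hb, hab⟩ := hR.exists_square η
  have hgη : cfc g R ξ = D b := by
    rw [hg, hab]
    rfl
  have hgint : ((∫ t, g (1 + t)⁻¹ ∂μ : ℝ) : ℂ) = ⟪D ξ, (b : H)⟫_ℂ := by
    rw [h g hgc, hgη, inner_apply_left hD]
  have hmint : ∫ t, m (1 + t)⁻¹ ∂μ = ‖(b : H)‖ ^ 2 := by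
    have h1 : ((∫ t, m (1 + t)⁻¹ ∂μ : ℝ) : ℂ) = ⟪(b : H), (b : H)⟫_ℂ := by
      rw [h m hmc, hm]
      change ⟪(ξ : H), cfc k R (R (((1 - R) * cfc k R) ξ))⟫_ℂ = _
      rw [← hg, hgη, ← hsymm (cfc_predicate k R), ← hη, ← hsymm hsa, ← ha, ← inner_apply_left hD,
        ← hb]
    rw [inner_self_eq_norm_sq_to_K] at h1
    exact Complex.ofReal_injective (h1.trans (by push_cast; rfl))
  have hle : ∫ t, m (1 + t)⁻¹ ∂μ ≤ ∫ t, g (1 + t)⁻¹ ∂μ := by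
    refine integral_mono_ae (hμ.integrable_comp hmc) (hμ.integrable_comp hgc) ?_
    filter_upwards [ae_nonneg_of_measure_Iio hμ.supported] with t ht
    have hs0 : 0 ≤ (1 + t)⁻¹ := by positivity
    have hs1 : (1 + t)⁻¹ ≤ 1 := inv_le_one_of_one_le₀ (by linarith)
    generalize (1 + t)⁻¹ = s at hs0 hs1
    have hks : k s * s ≤ 1 := by
      change (|s| + ε)⁻¹ * s ≤ 1
      rw [abs_of_nonneg hs0, inv_mul_le_iff₀ (by positivity)]
      linarith
    have hk0 : 0 ≤ g s := mul_nonneg (by linarith) (by positivity)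
    calc m s = (k s * s) * g s := by simp only [m, g]; ring
      _ ≤ 1 * g s := by gcongr
      _ = g s := one_mul _
  have hnorm : ∫ t, g (1 + t)⁻¹ ∂μ ≤ ‖D ξ‖ * ‖(b : H)‖ := by
    calc ∫ t, g (1 + t)⁻¹ ∂μ ≤ ‖((∫ t, g (1 + t)⁻¹ ∂μ : ℝ) : ℂ)‖ := by
          rw [Complex.norm_real]
          exact le_abs_self _
      _ ≤ ‖D ξ‖ * ‖(b : H)‖ := by
          rw [hgint]
          exact norm_inner_le_norm _ _
  rw [hmint] at hle
  change ∫ t, g (1 + t)⁻¹ ∂μ ≤ ‖D ξ‖ ^ 2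
  -- From `‖b‖² ≤ ∫ g ≤ ‖D ξ‖ ‖b‖`, by the inequality of arithmetic and geometric means.
  nlinarith [sq_nonneg (‖D ξ‖ - ‖(b : H)‖)]

/-- The first moment of the spectral measure of `D²` at `ξ ∈ dom D`. -/
theorem IsSpectralMeasureAt.integrable_and_integral_le {ξ : D.domain}
    (hμ : IsSpectralMeasureAt (square D) ξ μ) (hD : IsSelfAdjoint D) :
    Integrable (fun t : ℝ => t) μ ∧ ∫ t, t ∂μ ≤ ‖D ξ‖ ^ 2 := by
  have hnn := ae_nonneg_of_measure_Iio hμ.supported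
  let e : ℕ → ℝ := fun n => 1 / ((n : ℝ) + 1)
  have he : ∀ n, 0 < e n := fun n => Nat.one_div_pos_of_nat
  let F : ℕ → ℝ → ℝ := fun n t => (1 - (1 + t)⁻¹) * (|(1 + t)⁻¹| + e n)⁻¹
  have hFc : ∀ n, Continuous fun s : ℝ => (1 - s) * (|s| + e n)⁻¹ := fun n =>
    (by fun_prop : Continuous fun s : ℝ => 1 - s).mul
      (Continuous.inv₀ (by fun_prop) fun s => by have := he n; positivity)
  have hFm : ∀ n, Measurable (F n) := fun n => by fun_prop
  have hFi : ∀ n, Integrable (F n) μ := fun n => hμ.integrable_comp (hFc n)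
  have hF0 : ∀ n, 0 ≤ᵐ[μ] F n := fun n => by
    filter_upwards [hnn] with t ht
    have hs1 : (1 + t)⁻¹ ≤ 1 := inv_le_one_of_one_le₀ (by linarith)
    have := he n
    exact mul_nonneg (by linarith) (by positivity)
  have hlim : ∀ᵐ t ∂μ, Filter.liminf (fun n => ENNReal.ofReal (F n t)) Filter.atTop =
      ENNReal.ofReal t := by
    filter_upwards [hnn] with t ht
    refine Filter.Tendsto.liminf_eq (ENNReal.tendsto_ofReal ?_)
    have h0 : |(1 + t)⁻¹| ≠ 0 := by positivity
    have h1 : Filter.Tendsto (fun n => F n t) Filter.atTop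
        (nhds ((1 - (1 + t)⁻¹) * (|(1 + t)⁻¹| + 0)⁻¹)) :=
      ((tendsto_one_div_add_atTop_nhds_zero_nat.const_add _).inv₀ (by simpa using h0)).const_mul _
    have h2 : (1 - (1 + t)⁻¹) * (|(1 + t)⁻¹| + 0)⁻¹ = t := by
      rw [add_zero, abs_of_nonneg (by positivity), inv_inv]
      field_simp
      ring
    rwa [h2] at h1
  -- Fatou's lemma as the regularization `e n` tends to `0`.
  have hbound : ∫⁻ t, ENNReal.ofReal t ∂μ ≤ ENNReal.ofReal (‖D ξ‖ ^ 2) := by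
    rw [← lintegral_congr_ae hlim]
    refine (lintegral_liminf_le fun n => (hFm n).ennreal_ofReal).trans ?_
    refine Filter.liminf_le_of_frequently_le' (Filter.Frequently.of_forall fun n => ?_)
    rw [← ofReal_integral_eq_lintegral_ofReal (hFi n) (hF0 n)]
    exact ENNReal.ofReal_le_ofReal (hμ.integral_regularized_le hD (he n))
  have hint : Integrable (fun t : ℝ => t) μ :=
    (lintegral_ofReal_ne_top_iff_integrable aestronglyMeasurable_id hnn).1
      (ne_top_of_le_ne_top ENNReal.ofReal_ne_top hbound)
  refine ⟨hint, ?_⟩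
  rw [← ofReal_integral_eq_lintegral_ofReal hint hnn] at hbound
  exact (ENNReal.ofReal_le_ofReal_iff (sq_nonneg _)).1 hbound

/-- Jensen's inequality `exp ⟨log D²⟩ ≤ ⟨D²⟩` in the state given by a unit vector. -/
theorem IsSpectralMeasureAt.exp_integral_log_le {ξ : D.domain}
    (hμ : IsSpectralMeasureAt (square D) ξ μ) (hD : IsSelfAdjoint D)
    (hinj : ∀ x : D.domain, D x = 0 → x = 0) (hξ : ‖(ξ : H)‖ = 1)
    (hlog : Integrable Real.log μ) : Real.exp (∫ t, Real.log t ∂μ) ≤ ‖D ξ‖ ^ 2 := by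
  have : IsProbabilityMeasure μ := ⟨by
    have := hμ.finite
    have h1 := hμ.measureReal_univ hD
    rw [hξ, one_pow] at h1
    rw [← ENNReal.ofReal_one, ← h1, ofReal_measureReal]⟩
  obtain ⟨hint, hle⟩ := hμ.integrable_and_integral_le hD
  -- At `t = 0` the left side is `1`, so the absence of an atom there matters.
  have hpos : (fun t => Real.exp (Real.log t)) =ᵐ[μ] fun t => t := by
    have h0 : ∀ᵐ t ∂μ, t ≠ 0 := by
      rw [ae_iff]
      simpa using hμ.measure_zero hD hinj
    filter_upwards [ae_nonneg_of_measure_Iio hμ.supported, h0] with t ht ht0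
    exact Real.exp_log (lt_of_le_of_ne ht ht0.symm)
  calc Real.exp (∫ t, Real.log t ∂μ) ≤ ∫ t, Real.exp (Real.log t) ∂μ :=
        convexOn_exp.map_integral_le Real.continuous_exp.continuousOn isClosed_univ
          (Filter.Eventually.of_forall fun _ => Set.mem_univ _) hlog (hint.congr hpos.symm)
    _ = ∫ t, t ∂μ := integral_congr_ae hpos
    _ ≤ ‖D ξ‖ ^ 2 := hle

end Moments

/-! ### The Tomita operator and its polar decomposition -/

section Tomita

variable {H : Type*} [NormedAddCommGroup H] [InnerProductSpace ℂ H] [CompleteSpace H]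
  {M : VonNeumannAlgebra H} {Ω : H}

/-- The orbit `M Ω` as a subspace. -/
noncomputable def orbit (M : VonNeumannAlgebra H) (Ω : H) : Submodule ℂ H :=
  (Subalgebra.toSubmodule M.toStarSubalgebra.toSubalgebra).map
    (ContinuousLinearMap.apply ℂ H Ω : (H →L[ℂ] H) →ₗ[ℂ] H)

theorem mem_orbit {x : H} : x ∈ orbit M Ω ↔ ∃ A ∈ M, A Ω = x := Iff.rfl

theorem orbit_invariant {A : H →L[ℂ] H} (hA : A ∈ M) {x : H} (hx : x ∈ orbit M Ω) :
    A x ∈ orbit M Ω := by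
  obtain ⟨B, hB, rfl⟩ := mem_orbit.1 hx
  exact mem_orbit.2 ⟨A * B, mul_mem hA hB, rfl⟩

/-- A vector separating for `M` is cyclic for the commutant of `M`. -/
theorem IsSeparatingVector.isCyclicVector_commutant (hsep : IsSeparatingVector M Ω) :
    IsCyclicVector M.commutant Ω := by
  let K : Submodule ℂ H := (orbit M.commutant Ω).topologicalClosure
  have hK : CompleteSpace K := (Submodule.isClosed_topologicalClosure _).completeSpace_coe
  -- `K` is invariant under the commutant, so its projection lies in the bicommutant `M`. Its
  -- complement kills `Ω`, hence vanishes.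
  have hproj : K.starProjection ∈ M := by
    rw [VonNeumannAlgebra.IsStarProjection.mem_iff isStarProjection_starProjection]
    intro y hy
    have hinv : ∀ x ∈ K, y x ∈ K := by
      intro x hx
      exact map_mem_closure y.continuous hx fun z hz => orbit_invariant hy hz
    rw [Submodule.range_starProjection]
    exact hinv
  have hΩ : Ω ∈ K := Submodule.le_topologicalClosure _
    (mem_orbit.2 ⟨1, one_mem _, rfl⟩)
  have h1 : 1 - K.starProjection = 0 := by
    refine hsep _ (sub_mem (one_mem M) hproj) ?_
    rw [sub_apply, one_apply_eq_self, Submodule.starProjection_eq_self_iff.2 hΩ, sub_self]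
  have h2 : K = ⊤ := by
    rw [Submodule.eq_top_iff']
    intro x
    rw [← Submodule.starProjection_eq_self_iff, ← sub_eq_zero.1 h1]
    rfl
  have h3 : Dense (orbit M.commutant Ω : Set H) :=
    Submodule.dense_iff_topologicalClosure_eq_top.2 h2
  exact h3

/-- On `A Ω` both sides reduce to `⟪Ω, A b Ω⟫ = ⟪Ω, b A Ω⟫`, and the relation is closed. With `Ω`
cyclic for the commutant, it yields closability. -/
theorem inner_eq_of_mem_tomitaClosureGraph {p : H × H} (hp : p ∈ tomitaClosureGraph M Ω)
    {b : H →L[ℂ] H} (hb : b ∈ M.commutant) : ⟪p.2, b Ω⟫_ℂ = ⟪star b Ω, p.1⟫_ℂ := by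
  have hclosed : IsClosed {p : H × H | ⟪p.2, b Ω⟫_ℂ = ⟪star b Ω, p.1⟫_ℂ} :=
    isClosed_eq (by fun_prop) (by fun_prop)
  refine closure_minimal ?_ hclosed hp
  rintro _ ⟨A, hA, rfl⟩
  change ⟪star A Ω, b Ω⟫_ℂ = ⟪star b Ω, A Ω⟫_ℂ
  rw [ContinuousLinearMap.star_eq_adjoint, ContinuousLinearMap.star_eq_adjoint,
    ContinuousLinearMap.adjoint_inner_left, ContinuousLinearMap.adjoint_inner_left]
  have hcomm : A * b = b * A := VonNeumannAlgebra.mem_commutant_iff.1 hb A hA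
  exact congrArg (fun T : H →L[ℂ] H => ⟪Ω, T Ω⟫_ℂ) hcomm

theorem tomitaClosureGraph_swap {p : H × H} (hp : p ∈ tomitaClosureGraph M Ω) :
    p.swap ∈ tomitaClosureGraph M Ω := by
  refine map_mem_closure continuous_swap hp ?_
  rintro _ ⟨A, hA, rfl⟩
  exact ⟨star A, star_mem hA, by rw [star_star]; rfl⟩

/-- The Tomita operator is closable. -/
theorem snd_eq_zero_of_mem_tomitaClosureGraph (hsep : IsSeparatingVector M Ω) {y : H}
    (h : ((0 : H), y) ∈ tomitaClosureGraph M Ω) : y = 0 := by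
  refine hsep.isCyclicVector_commutant.eq_zero_of_inner_left ℂ fun x hx => ?_
  obtain ⟨b, hb, rfl⟩ := hx
  rw [inner_eq_of_mem_tomitaClosureGraph h hb, inner_zero_right]

/-- The closure of the Tomita operator is injective. -/
theorem fst_eq_zero_of_mem_tomitaClosureGraph (hsep : IsSeparatingVector M Ω) {x : H}
    (h : (x, (0 : H)) ∈ tomitaClosureGraph M Ω) : x = 0 :=
  snd_eq_zero_of_mem_tomitaClosureGraph hsep (tomitaClosureGraph_swap h)

theorem add_mem_tomitaClosureGraph {p q : H × H} (hp : p ∈ tomitaClosureGraph M Ω)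
    (hq : q ∈ tomitaClosureGraph M Ω) : p + q ∈ tomitaClosureGraph M Ω := by
  refine map_mem_closure₂ continuous_add hp hq ?_
  rintro _ ⟨A, hA, rfl⟩ _ ⟨B, hB, rfl⟩
  exact ⟨A + B, add_mem hA hB, by rw [star_add]; rfl⟩

theorem smul_mem_tomitaClosureGraph (c : ℂ) {p : H × H} (hp : p ∈ tomitaClosureGraph M Ω) :
    (c • p.1, star c • p.2) ∈ tomitaClosureGraph M Ω := by
  refine map_mem_closure (f := fun p : H × H => (c • p.1, star c • p.2)) (by fun_prop) hp ?_
  rintro _ ⟨A, hA, rfl⟩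
  exact ⟨c • A, M.toStarSubalgebra.smul_mem hA c, by rw [star_smul]; rfl⟩

theorem zero_mem_tomitaClosureGraph : (0 : H × H) ∈ tomitaClosureGraph M Ω :=
  subset_closure ⟨0, zero_mem M, by rw [star_zero]; rfl⟩

/-- The polar decomposition of the closure of the Tomita operator exists. -/
theorem exists_isPolarDecomposition (hcyc : IsCyclicVector M Ω) (hsep : IsSeparatingVector M Ω) :
    ∃ D : H →ₗ.[ℂ] H, ∃ J : H ≃ₗᵢ⋆[ℂ] H, IsPolarDecomposition (tomitaClosureGraph M Ω) J D := by
  -- Composition with `θ` makes the graph complex linear. If `V` is the unitary factor found for it,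
  -- then `J = θ⁻¹ V`.
  obtain ⟨θ⟩ := exists_antiunitary (E := H)
  let Γ : Submodule ℂ (WithLp 2 (H × H)) :=
    { carrier := {z | (z.fst, θ.symm z.snd) ∈ tomitaClosureGraph M Ω}
      zero_mem' := by
        change ((0 : H), θ.symm 0) ∈ tomitaClosureGraph M Ω
        rw [map_zero]
        exact zero_mem_tomitaClosureGraph
      add_mem' := by
        intro z w hz hw
        have := add_mem_tomitaClosureGraph hz hw
        rwa [Prod.mk_add_mk, ← map_add] at this
      smul_mem' := by
        intro c z hz
        have := smul_mem_tomitaClosureGraph c hz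
        change (c • z.fst, θ.symm (c • z.snd)) ∈ tomitaClosureGraph M Ω
        rw [LinearIsometryEquiv.map_smulₛₗ]
        exact this }
  have hmem : ∀ {z : WithLp 2 (H × H)},
      z ∈ Γ ↔ (z.fst, θ.symm z.snd) ∈ tomitaClosureGraph M Ω := Iff.rfl
  have hext : ∀ {z : WithLp 2 (H × H)}, z.fst = 0 → z.snd = 0 → z = 0 := fun h1 h2 =>
    WithLp.ofLp_injective 2 (Prod.ext h1 h2)
  have hΓ : IsClosed (Γ : Set (WithLp 2 (H × H))) := by
    have hc : Continuous fun z : WithLp 2 (H × H) => (z.fst, θ.symm z.snd) :=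
      (WithLp.fstL 2 ℂ H H).continuous.prodMk
        (θ.symm.continuous.comp (WithLp.sndL 2 ℂ H H).continuous)
    exact (isClosed_closure (s := tomitaGraph M Ω)).preimage hc
  have horbit : ∀ A ∈ M, WithLp.toLp 2 (A Ω, θ (star A Ω)) ∈ Γ := by
    intro A hA
    rw [hmem]
    change (A Ω, θ.symm (θ (star A Ω))) ∈ _
    rw [θ.symm_apply_apply]
    exact subset_closure ⟨A, hA, rfl⟩
  obtain ⟨A, C, hAC, V, hV⟩ := exists_isCosSinPair_of_isClosed Γ hΓ
    (by
      intro z hz h0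
      rw [hmem, h0] at hz
      exact hext h0 (by simpa using snd_eq_zero_of_mem_tomitaClosureGraph hsep hz))
    (by
      intro z hz h0
      rw [hmem, h0, map_zero] at hz
      exact hext (fst_eq_zero_of_mem_tomitaClosureGraph hsep hz) h0)
    (by
      refine Dense.mono ?_ hcyc
      rintro _ ⟨A, hA, rfl⟩
      exact ⟨_, horbit A hA, rfl⟩)
    (by
      have h1 : Dense (θ '' {x : H | ∃ A ∈ M, A Ω = x}) :=
        θ.surjective.denseRange.dense_image θ.continuous hcyc
      refine h1.mono ?_
      rintro _ ⟨_, ⟨A, hA, rfl⟩, rfl⟩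
      refine ⟨_, horbit (star A) (star_mem hA), ?_⟩
      rw [star_star]
      rfl)
  obtain ⟨D, hD, hgraph⟩ := hAC.exists_isPositiveSelfAdjoint
  refine ⟨D, V.trans θ.symm, hD, ?_⟩
  ext ⟨x, y⟩
  have h1 : (x, y) ∈ tomitaClosureGraph M Ω ↔ ∃ u, x = A u ∧ θ y = V (C u) := by
    rw [← hV, hmem]
    change _ ↔ (x, θ.symm (θ y)) ∈ _
    rw [θ.symm_apply_apply]
  rw [h1]
  constructor
  · rintro ⟨u, rfl, hu⟩
    obtain ⟨d, hd⟩ := (hgraph (A u, C u)).2 ⟨u, rfl⟩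
    obtain ⟨hd1, hd2⟩ := Prod.mk.inj hd
    refine ⟨d, Prod.ext hd1 ?_⟩
    change y = θ.symm (V (D d))
    rw [← hd2, ← hu, θ.symm_apply_apply]
  · rintro ⟨d, hd⟩
    obtain ⟨u, hu⟩ := (hgraph ((d : H), D d)).1 ⟨d, rfl⟩
    obtain ⟨hu1, hu2⟩ := Prod.mk.inj hu
    obtain ⟨hd1, hd2⟩ := Prod.mk.inj hd
    refine ⟨u, hd1.trans hu1, ?_⟩
    rw [hd2, ← hu2]
    exact θ.apply_symm_apply _

theorem exists_isPolarDecomposition_modularSqrt (hcyc : IsCyclicVector M Ω)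
    (hsep : IsSeparatingVector M Ω) : ∃ J : H ≃ₗᵢ⋆[ℂ] H,
      IsPolarDecomposition (tomitaClosureGraph M Ω) J (modularSqrt M Ω) := by
  have h := exists_isPolarDecomposition hcyc hsep
  rw [modularSqrt, dif_pos h]
  exact h.choose_spec

section

variable {J : H ≃ₗᵢ⋆[ℂ] H} {D : H →ₗ.[ℂ] H}

theorem IsPolarDecomposition.eq_zero_of_apply_eq_zero
    (h : IsPolarDecomposition (tomitaClosureGraph M Ω) J D) (hsep : IsSeparatingVector M Ω)
    (x : D.domain) (hx : D x = 0) : x = 0 := by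
  have h1 : ((x : H), J (D x)) ∈ tomitaClosureGraph M Ω := by
    rw [h.graph_eq]
    exact ⟨x, rfl⟩
  rw [hx, map_zero] at h1
  exact Subtype.ext (fst_eq_zero_of_mem_tomitaClosureGraph hsep h1)

/-- The pair `(B Ω, star B Ω)` lies in the graph of `J D`, and `J` is isometric. -/
theorem IsPolarDecomposition.exists_norm_apply_eq
    (h : IsPolarDecomposition (tomitaClosureGraph M Ω) J D) {B : H →L[ℂ] H} (hB : B ∈ M) :
    ∃ hx : B Ω ∈ D.domain, ‖D ⟨B Ω, hx⟩‖ = ‖star B Ω‖ := by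
  have h1 : (B Ω, star B Ω) ∈ tomitaClosureGraph M Ω := subset_closure ⟨B, hB, rfl⟩
  rw [h.graph_eq] at h1
  obtain ⟨⟨x, hx⟩, hxB⟩ := h1
  obtain ⟨rfl, h2⟩ := Prod.mk.inj hxB
  exact ⟨hx, by rw [h2, LinearIsometryEquiv.norm_map]⟩

end

omit [CompleteSpace H] in
theorem norm_normalized {x : H} (hx : x ≠ 0) : ‖normalized x‖ = 1 := by
  rw [normalized, norm_smul, norm_inv, Complex.norm_real, norm_norm,
    inv_mul_cancel₀ (norm_ne_zero_iff.2 hx)]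

end Tomita

end TomitaTakesaki

/-! ### The two bounds on the success probability -/

theorem corollary2 {H : Type*} [NormedAddCommGroup H] [InnerProductSpace ℂ H] [CompleteSpace H]
    (M : VonNeumannAlgebra H) (Ω : H) (hΩ : ‖Ω‖ = 1)
    (hcyc : TomitaTakesaki.IsCyclicVector M Ω) (hsep : TomitaTakesaki.IsSeparatingVector M Ω)
    (B : H →L[ℂ] H) (hBM : B ∈ M) (hB : ‖B‖ ≤ 1) (hBΩ : B Ω ≠ 0) :
    (∃ h : TomitaTakesaki.normalized (B Ω) ∈ (TomitaTakesaki.modularSqrt M Ω).domain,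
      TomitaTakesaki.successProbability Ω B ≤
        (‖TomitaTakesaki.modularSqrt M Ω ⟨TomitaTakesaki.normalized (B Ω), h⟩‖ ^ 2)⁻¹) ∧
    (TomitaTakesaki.HasFiniteModularEnergy M Ω (TomitaTakesaki.normalized (B Ω)) →
      Real.exp (-TomitaTakesaki.modularEnergy M Ω (TomitaTakesaki.normalized (B Ω))) ≤
        (TomitaTakesaki.successProbability Ω B)⁻¹) := by
  open TomitaTakesaki in
  obtain ⟨J, hJ⟩ := exists_isPolarDecomposition_modularSqrt hcyc hsep
  have hD : IsSelfAdjoint (modularSqrt M Ω) := hJ.positive.selfAdjoint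
  obtain ⟨hdom, hnorm⟩ := hJ.exists_norm_apply_eq hBM
  have hBpos : 0 < ‖B Ω‖ := norm_pos_iff.2 hBΩ
  have hmem : normalized (B Ω) ∈ (modularSqrt M Ω).domain :=
    (modularSqrt M Ω).domain.smul_mem _ hdom
  have hval : ‖modularSqrt M Ω ⟨normalized (B Ω), hmem⟩‖ = ‖star B Ω‖ / ‖B Ω‖ := by
    have h1 := (modularSqrt M Ω).map_smul ((‖B Ω‖ : ℂ)⁻¹) ⟨B Ω, hdom⟩
    have h2 : modularSqrt M Ω ⟨normalized (B Ω), hmem⟩ =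
        ((‖B Ω‖ : ℂ)⁻¹) • modularSqrt M Ω ⟨B Ω, hdom⟩ := h1
    rw [h2, norm_smul, hnorm, norm_inv, Complex.norm_real, norm_norm, inv_mul_eq_div]
  have hstar1 : ‖star B Ω‖ ≤ 1 := by
    refine ((star B).le_opNorm Ω).trans ?_
    rwa [hΩ, mul_one, norm_star]
  -- Strict positivity, from `Ω` being separating, is needed to invert the bound: with `0⁻¹ = 0` it
  -- would fail otherwise.
  have hstar0 : 0 < ‖star B Ω‖ := by
    rw [norm_pos_iff]
    intro h0
    have h1 := hsep _ (star_mem hBM) h0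
    rw [star_eq_zero] at h1
    exact hBΩ (by rw [h1]; rfl)
  have hsq : ‖modularSqrt M Ω ⟨normalized (B Ω), hmem⟩‖ ^ 2 ≤ (successProbability Ω B)⁻¹ := by
    rw [hval, successProbability, div_pow, div_eq_mul_inv]
    exact mul_le_of_le_one_left (by positivity) (pow_le_one₀ hstar0.le hstar1)
  refine ⟨⟨hmem, ?_⟩, fun hfin => ?_⟩
  · refine le_inv_of_le_inv₀ ?_ hsq
    rw [hval]
    positivity
  -- Existence ensures that the chosen measure is the spectral one and not the default `0`.
  · have hex := exists_isSpectralMeasureAt_square hD (normalized (B Ω))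
    have hμ : IsSpectralMeasureAt (square (modularSqrt M Ω)) (normalized (B Ω))
        (spectralMeasureAt (modularOperator M Ω) (normalized (B Ω))) := by
      rw [modularOperator, spectralMeasureAt, dif_pos hex]
      exact hex.choose_spec
    have hmeas : AEMeasurable (fun t => -Real.log t)
        (spectralMeasureAt (modularOperator M Ω) (normalized (B Ω))) :=
      Real.measurable_log.neg.aemeasurable
    have hlog := (integrable_map_measure aestronglyMeasurable_id hmeas).1 hfin
    have henergy : -modularEnergy M Ω (normalized (B Ω)) =
        ∫ t, Real.log t ∂spectralMeasureAt (modularOperator M Ω) (normalized (B Ω)) := by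
      rw [modularEnergy, modularEnergyMeasure, integral_map (f := fun x => x) hmeas aestronglyMeasurable_id,
        integral_neg, neg_neg]
    rw [henergy]
    refine le_trans ?_ hsq
    exact hμ.exp_integral_log_le (ξ := ⟨normalized (B Ω), hmem⟩) hD
      (hJ.eq_zero_of_apply_eq_zero hsep) (norm_normalized hBΩ) (by simpa using! hlog.neg)
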